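/- Let $n$ be a positive integer. A labeled $n$-multigraph is a finite multigraph $G$ with vertex set $\{0,1,\dots,n\}$, without loops, with at most one edge $0k$ for each $k\in\{1,\dots,n\}$, and such that every edge between vertices $1\le i<j\le n$ carries a label $\zeta\in\mathbb{C}\setminus\{0\}$ (the edge is then written $ij^{\zeta}$), no two edges with the same endpoints having the same label. A set $F$ of edges of $G$, regarded as a spanning subgraph of $G$, is an increasing spanning forest if it has no cycle (two edges with the same endpoints count as a cycle) and, for each connected component of $F$, the vertices along every path starting at the smallest vertex of that component form an increasing sequence. Let $\mathrm{isf}_m(G)$ be the number of increasing spanning forests of $G$ with exactly $m$ edges, and let $$\mathrm{ISF}(G,t)=\sum_{m=0}^{n}\mathrm{isf}_m(G)\,t^{\,n-m}.$$ Let $\mathcal{A}(G)$ be the arrangement in $\mathbb{C}^n$ consisting of the hyperplanes $x_i=\gamma x_j$ for all edges $ij^{\gamma}$ of $G$ with $1\le i<j\le n$, and $x_k=0$ for all edges $0k$ of $G$. Let $L=L(G)$ be its intersection lattice, i.e. the set of all intersections of subfamilies of $\mathcal{A}(G)$ (including the empty intersection $\hat 0=\mathbb{C}^n$), ordered by reverse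 inclusion, with maximum $\hat 1$. Let $\rho$ be the rank function of $L$, $\rho(L)=\rho(\hat 1)$, let $\mu$ be the Möbius function of $L$, and let $$\chi(L,t)=\sum_{x\in L}\mu(\hat 0,x)\,t^{\,\rho(L)-\rho(x)}.$$ Call $G$ perfectly labeled if the following hold. 1. For all $1\le i<j<k\le n$: if $G$ has edges $ik^{\alpha}$ and $jk^{\beta}$, then it has an edge $ij^{\alpha/\beta}$. 2. For all $1\le j<k\le n$: if $G$ has edges $jk^{\gamma}$ and $jk^{\epsilon}$ with $\gamma\ne\epsilon$, then it has an edge $0j$. 3. For all $1\le j<k\le n$: if $G$ has edges $jk^{\gamma}$ and $0k$, then it has an edge $0j$. Theorem. For every labeled $n$-multigraph $G$, the identity of polynomials in $t$ $$\mathrm{ISF}(G,t)=(-1)^{\rho(L)}\,t^{\,n-\rho(L)}\,\chi(L,-t)$$ holds if and only if $G$ is perfectly labeled. -/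

import Mathlib

open Polynomial

/-- A possible edge of a labeled `n`-multigraph.  The vertex set is `{0, 1, …, n}`, modelled by
`Fin (n + 1)`; the nonzero vertices `1, …, n` are indexed by `Fin n` through `Fin.succ`.
`zero k` is the edge joining `0` to the nonzero vertex `k`, and `link i j hij ζ` is the edge
`ij^ζ` joining the nonzero vertices `i < j`, with the nonzero complex label `ζ`. -/
inductive MEdge (n : ℕ) : Type where
  | zero (k : Fin n) : MEdge n
  | link (i j : Fin n) (hij : i < j) (ζ : ℂˣ) : MEdge n

namespace MEdge

/-- The two endpoints of an edge. -/
def ends {n : ℕ} : MEdge n → Sym2 (Fin (n + 1))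
  | zero k => s(0, k.succ)
  | link i j _ _ => s(i.succ, j.succ)

/-- The hyperplane of an edge in `ℂⁿ`: `x_k = 0` for `0k`, and `x_i = ζ x_j` for `ij^ζ`. -/
def hyperplane {n : ℕ} : MEdge n → Submodule ℂ (Fin n → ℂ)
  | zero k => LinearMap.ker (LinearMap.proj k : (Fin n → ℂ) →ₗ[ℂ] ℂ)
  | link i j _ ζ => LinearMap.ker
      ((LinearMap.proj i : (Fin n → ℂ) →ₗ[ℂ] ℂ) - (ζ : ℂ) • LinearMap.proj j)

end MEdge

/-- A labeled `n`-multigraph: a finite multigraph on `{0, …, n}` without loops, with at most one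
edge `0k` for each `k`, and whose edges between nonzero vertices carry nonzero complex labels,
edges with the same endpoints having distinct labels.  Such a multigraph is the same thing as a
finite set of edges of the above form. -/
structure LabeledMultigraph (n : ℕ) where
  /-- the edge set -/
  edges : Finset (MEdge n)

/-- The simple graph on `{0, …, n}` underlying the spanning subgraph with edge set `F`. -/
def underlyingGraph {n : ℕ} (F : Finset (MEdge n)) : SimpleGraph (Fin (n + 1)) :=
  SimpleGraph.fromEdgeSet (MEdge.ends '' (F : Set (MEdge n)))

/-- The spanning subgraph with edge set `F` is a forest, where two edges with the same endpoints
count as a cycle. -/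
def IsSpanningForest {n : ℕ} (F : Finset (MEdge n)) : Prop :=
  Set.InjOn MEdge.ends (F : Set (MEdge n)) ∧ (underlyingGraph F).IsAcyclic

/-- `F` is an increasing spanning forest: it is a forest, and the vertices along any path that
starts at the smallest vertex `r` of its component form an increasing sequence. -/
def IsIncreasingForest {n : ℕ} (F : Finset (MEdge n)) : Prop :=
  IsSpanningForest F ∧
    ∀ r : Fin (n + 1), (∀ v, (underlyingGraph F).Reachable r v → r ≤ v) →
      ∀ (v : Fin (n + 1)) (p : (underlyingGraph F).Walk r v), p.IsPath →
        p.support.Pairwise (· < ·)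

/-- The rank of an element of a finite poset: the maximal length of a chain ending at it. -/
noncomputable def posetRank {P : Type*} [Preorder P] (x : P) : ℕ := (Order.height x).toNat

open Classical in
/-- The characteristic polynomial `∑ x, μ(0̂, x) t ^ (ρ(P) - ρ(x))` of a finite (ranked) poset `P`
with `0̂` and `1̂`, where `ρ(P) = ρ(1̂)`. -/
noncomputable def charPolynomial (P : Type*) [PartialOrder P] [BoundedOrder P] [Fintype P] :
    ℤ[X] :=
  letI : LocallyFiniteOrder P := Fintype.toLocallyFiniteOrder
  ∑ x : P, C (IncidenceAlgebra.mu ℤ (⊥ : P) x) * X ^ (posetRank (⊤ : P) - posetRank x)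

namespace LabeledMultigraph

variable {n : ℕ} (G : LabeledMultigraph n)

open Classical in
/-- The number of increasing spanning forests of `G` with `m` edges. -/
noncomputable def isf (m : ℕ) : ℕ :=
  (G.edges.powerset.filter fun F => IsIncreasingForest F ∧ F.card = m).card

/-- The generating function `∑ m, isf_m(G) t ^ (n - m)`; a forest on `n + 1` vertices has at most
`n` edges, so that all the increasing spanning forests are counted. -/
noncomputable def ISF : ℤ[X] :=
  ∑ m ∈ Finset.range (n + 1), C (G.isf m : ℤ) * X ^ (n - m)

/-- The hyperplane arrangement of `G` in `ℂⁿ`. -/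
def arrangement : Set (Submodule ℂ (Fin n → ℂ)) :=
  MEdge.hyperplane '' (G.edges : Set (MEdge n))

/-- The intersection lattice of `G`: all intersections of subfamilies of the arrangement (the empty
intersection being `ℂⁿ`), ordered by reverse inclusion. -/
abbrev IntersectionLattice : Type :=
  {W : Submodule ℂ (Fin n → ℂ) // ∃ B ⊆ G.arrangement, sInf B = W}ᵒᵈ

instance : Finite G.IntersectionLattice := by
  have h : (G.arrangement).Finite := G.edges.finite_toSet.image _
  have h2 : {W : Submodule ℂ (Fin n → ℂ) | ∃ B ⊆ G.arrangement, sInf B = W}.Finite :=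
    h.finite_subsets.image sInf
  exact h2.to_subtype

noncomputable instance : Fintype G.IntersectionLattice := Fintype.ofFinite _

instance : BoundedOrder G.IntersectionLattice where
  bot := OrderDual.toDual ⟨⊤, ∅, Set.empty_subset _, sInf_empty⟩
  bot_le x := show (OrderDual.ofDual x).1 ≤ ⊤ from le_top
  top := OrderDual.toDual ⟨sInf G.arrangement, G.arrangement, subset_rfl, rfl⟩
  le_top x := show sInf G.arrangement ≤ (OrderDual.ofDual x).1 by
    obtain ⟨B, hB, h⟩ := (OrderDual.ofDual x).2
    exact h ▸ sInf_le_sInf hB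

/-- The rank `ρ(L)` of the intersection lattice, i.e. the rank of its maximum. -/
noncomputable def rank : ℕ := posetRank (⊤ : G.IntersectionLattice)

/-- `G` is perfectly labeled.  All the vertices `i`, `j`, `k` below are nonzero. -/
def PerfectlyLabeled : Prop :=
  (∀ (i j k : Fin n) (hij : i < j) (hjk : j < k) (α β : ℂˣ),
    MEdge.link i k (hij.trans hjk) α ∈ G.edges → MEdge.link j k hjk β ∈ G.edges →
      MEdge.link i j hij (α / β) ∈ G.edges) ∧
  (∀ (j k : Fin n) (hjk : j < k) (γ ε : ℂˣ), γ ≠ ε →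
    MEdge.link j k hjk γ ∈ G.edges → MEdge.link j k hjk ε ∈ G.edges →
      MEdge.zero j ∈ G.edges) ∧
  (∀ (j k : Fin n) (hjk : j < k) (γ : ℂˣ),
    MEdge.link j k hjk γ ∈ G.edges → MEdge.zero k ∈ G.edges → MEdge.zero j ∈ G.edges)

end LabeledMultigraph

/-!
The edges of `G` are sorted into classes by their larger endpoint. An edge set is an increasing
spanning forest exactly when it meets each class at most once (`isIncreasingForest_iff`); such sets
are called transversals. The equations of the hyperplanes in a transversal `S` are in echelon form,
so their intersection has rank `|S|` (`posetRank_flat`). Hence both sides of the identity have the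
form `∑ x, w(x) (-1) ^ ρ(x) t ^ (n - ρ(x))` over the intersection lattice, where `w` is the Möbius
function `μ(0̂, ·)` on the right and, on the left, the signed count `f` of the transversals with
intersection `x` (`LabeledMultigraph.flatWeight`).

The sum of `μ(0̂, ·)` over the flats below `x` is `1` or `0`, according to whether `x = 0̂`; the sum
of `f` is the signed count `T(x)` of the transversals among the edges whose hyperplanes contain `x`.
This count is the product over all classes of `1` minus the size of the class, but only two cases
are used: it vanishes when some class has exactly one element, and it is `1 - a` when there is a
single nonempty class, of size `a`.

`G` is perfectly labeled if and only if, for any two edges in the same class, the intersection of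
their hyperplanes lies in the hyperplane of an edge of another class, and that edge then belongs to
a lower class. If this holds, the lowest nonempty class of edges above `x ≠ 0̂` is a singleton, so
`T(x) = 0` for all `x ≠ 0̂`, and `f = μ` by induction. Conversely, `f` and `μ` always agree in rank
at most one, and `f(x) - μ(x) = T(x)` in rank two. There `T(x) ≤ 0`, since `T(x) ≠ 0` forces all
edges above `x` into a single class. Comparing coefficients of `t ^ (n - 2)`, the identity of
polynomials gives `T(x) = 0` for all `x` of rank two, so that no such `x` has all its edges in one
class.
-/

/-! ### Increasing forests as transversals -/

namespace MEdge

variable {n : ℕ}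

/-- The larger endpoint of an edge; it is never the vertex `0`, so it is indexed by `Fin n`. -/
def top : MEdge n → Fin n
  | zero k => k
  | link _ j _ _ => j

/-- The smaller endpoint of an edge, as a vertex of `{0, …, n}`. -/
def bot : MEdge n → Fin (n + 1)
  | zero _ => 0
  | link i _ _ _ => i.succ

lemma ends_eq (e : MEdge n) : e.ends = s(e.bot, e.top.succ) := by
  cases e <;> rfl

lemma bot_lt_top (e : MEdge n) : e.bot < e.top.succ := by
  cases e with
  | zero k => exact Fin.succ_pos k
  | link i j hij ζ => exact Fin.succ_lt_succ_iff.2 hij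

lemma ends_eq_mk_iff {e : MEdge n} {a b : Fin (n + 1)} (hab : a < b) :
    e.ends = s(a, b) ↔ e.bot = a ∧ e.top.succ = b := by
  rw [ends_eq, Sym2.eq_iff]
  refine ⟨?_, Or.inl⟩
  rintro (h | ⟨rfl, rfl⟩)
  · exact h
  · exact absurd hab e.bot_lt_top.asymm

end MEdge

section Forest

variable {n : ℕ} {F : Finset (MEdge n)}

lemma underlyingGraph_adj_iff {a b : Fin (n + 1)} (hab : a < b) :
    (underlyingGraph F).Adj a b ↔ ∃ e ∈ F, e.bot = a ∧ e.top.succ = b := by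
  simp [underlyingGraph, SimpleGraph.fromEdgeSet_adj, hab.ne, MEdge.ends_eq_mk_iff hab]

/-- If distinct edges of `F` have distinct larger endpoints, then every vertex has at most one
smaller neighbour. -/
lemma eq_of_adj_of_lt (h : Set.InjOn MEdge.top (F : Set (MEdge n))) {a b c : Fin (n + 1)}
    (ha : (underlyingGraph F).Adj c a) (hb : (underlyingGraph F).Adj c b) (hac : a < c)
    (hbc : b < c) : a = b := by
  obtain ⟨e, he, rfl, rfl⟩ := (underlyingGraph_adj_iff hac).1 ha.symm
  obtain ⟨f, hf, rfl, hfe⟩ := (underlyingGraph_adj_iff hbc).1 hb.symm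
  rw [h he hf (Fin.succ_injective _ hfe.symm)]

lemma isAcyclic_of_injOn_top (h : Set.InjOn MEdge.top (F : Set (MEdge n))) :
    (underlyingGraph F).IsAcyclic := by
  intro u c hc
  -- Both neighbours on the cycle of its largest vertex are smaller.
  obtain ⟨m, hm, hmax⟩ := c.support.toFinset.exists_max_image id ⟨u, by simp⟩
  rw [List.mem_toFinset] at hm
  have hc' := hc.rotate hm
  have hle : ∀ v ∈ (c.rotate m hm).support, v ≤ m := fun v hv =>
    hmax v (by simpa using hv)
  have h1 := (c.rotate m hm).adj_snd hc'.not_nil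
  have h2 := (c.rotate m hm).adj_penultimate hc'.not_nil
  refine hc'.snd_ne_penultimate (eq_of_adj_of_lt h h1 h2.symm ?_ ?_)
  · exact lt_of_le_of_ne (hle _ (SimpleGraph.Walk.getVert_mem_support _ _)) h1.ne'
  · exact lt_of_le_of_ne (hle _ (SimpleGraph.Walk.getVert_mem_support _ _)) h2.ne

/-- A path whose first step goes up keeps going up, since a vertex at which it turned down would
have two smaller neighbours. -/
lemma pairwise_support_cons (h : Set.InjOn MEdge.top (F : Set (MEdge n))) :
    ∀ {u w v : Fin (n + 1)} (huw : (underlyingGraph F).Adj u w)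
      (p : (underlyingGraph F).Walk w v), u < w → (SimpleGraph.Walk.cons huw p).IsPath →
      (SimpleGraph.Walk.cons huw p).support.Pairwise (· < ·) := by
  intro u w v huw p
  induction p generalizing u with
  | nil => intro hlt _; simpa using hlt
  | @cons w x v hwx p ih =>
    intro hlt hp
    have hux : u ≠ x := by
      rintro rfl
      simp [SimpleGraph.Walk.cons_isPath_iff] at hp
    have hwx' : w < x := by
      rcases lt_trichotomy w x with h1 | h1 | h1
      · exact h1
      · exact absurd h1 hwx.ne
      · exact absurd (eq_of_adj_of_lt h huw.symm hwx hlt h1) hux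
    have := ih hwx hwx' hp.of_cons
    rw [SimpleGraph.Walk.support_cons, List.pairwise_cons]
    refine ⟨fun y hy => ?_, this⟩
    rw [SimpleGraph.Walk.support_cons] at this hy
    rcases List.mem_cons.1 hy with rfl | hy
    · exact hlt
    · exact hlt.trans ((List.pairwise_cons.1 this).1 y hy)

/-- Increasing spanning forests are the edge sets in which every vertex is the larger endpoint of
at most one edge. -/
lemma isIncreasingForest_iff :
    IsIncreasingForest F ↔ Set.InjOn MEdge.top (F : Set (MEdge n)) := by
  constructor
  · rintro ⟨⟨hinj, hac⟩, hinc⟩ e he f hf hef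
    by_contra hne
    have hbot : e.bot ≠ f.bot := fun hb => hne (hinj he hf (by
      rw [MEdge.ends_eq, MEdge.ends_eq, hb, hef]))
    have hadj : ∀ g ∈ F, (underlyingGraph F).Adj g.bot g.top.succ := fun g hg =>
      (underlyingGraph_adj_iff g.bot_lt_top).2 ⟨g, hg, rfl, rfl⟩
    have he' := hadj e he
    have hf' := hadj f hf
    rw [← hef] at hf'
    obtain ⟨r, hr, hmin⟩ := (Set.toFinite
      {v | (underlyingGraph F).Reachable e.top.succ v}).exists_minimalFor id _ ⟨_, .refl _⟩
    have hmin' : ∀ v, (underlyingGraph F).Reachable r v → r ≤ v := fun v hv =>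
      (le_total r v).elim id fun hvr => hmin (hr.trans hv) hvr
    -- Increasing paths from the root to the two smaller neighbours extend to the common larger one.
    have key : ∀ a, (ha : (underlyingGraph F).Adj a e.top.succ) → a < e.top.succ →
        ∃ p : (underlyingGraph F).Walk r a, (p.concat ha).IsPath := by
      intro a ha hlt
      obtain ⟨p, hp⟩ := ((Set.mem_ofPred.1 hr).symm.trans ha.symm.reachable).exists_isPath
      refine ⟨p, hp.concat (fun hmem => ?_) ha⟩
      have hpw := hinc r hmin' a p hp
      have hle : ∀ v ∈ p.support, v ≤ a := by
        intro v hv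
        rw [← List.dropLast_append_getLast p.support_ne_nil, List.pairwise_append] at hpw
        rw [← List.dropLast_append_getLast p.support_ne_nil, List.mem_append] at hv
        rw [SimpleGraph.Walk.getLast_support] at hv hpw
        rcases hv with hv | hv
        · exact (hpw.2.2 v hv a (by simp)).le
        · exact (List.mem_singleton.1 hv).le
      exact absurd hlt (hle _ hmem).not_gt
    obtain ⟨p, hp⟩ := key _ he' e.bot_lt_top
    obtain ⟨q, hq⟩ := key _ hf' (hef ▸ f.bot_lt_top)
    have := congrArg SimpleGraph.Walk.penultimate
      (congrArg Subtype.val ((hac.subsingleton_path r _).elim ⟨_, hp⟩ ⟨_, hq⟩))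
    simp at this
    exact hbot this
  · intro h
    refine ⟨⟨fun e he f hf hef => h he hf ?_, isAcyclic_of_injOn_top h⟩, ?_⟩
    · rw [MEdge.ends_eq f, MEdge.ends_eq_mk_iff f.bot_lt_top] at hef
      exact Fin.succ_injective _ hef.2
    · intro r hr v p hp
      cases p with
      | nil => simp
      | cons hadj p =>
        exact pairwise_support_cons h hadj p
          (lt_of_le_of_ne (hr _ hadj.reachable) hadj.ne) hp

end Forest

/-! ### Signed counts of transversals -/

section Transversal

variable {α κ : Type*} (c : α → κ)

open Classical in
/-- The finite subsets of `B` that meet each fibre of `c` at most once. -/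
noncomputable def transversals (B : Finset α) : Finset (Finset α) :=
  B.powerset.filter fun S => Set.InjOn c (S : Set α)

/-- The number of transversals of `B`, counted with the sign `(-1) ^ |S|`. -/
noncomputable def signedTransversals (B : Finset α) : ℤ :=
  ∑ S ∈ transversals c B, (-1) ^ S.card

variable {c}

lemma mem_transversals {B S : Finset α} :
    S ∈ transversals c B ↔ S ⊆ B ∧ Set.InjOn c (S : Set α) := by
  simp [transversals]

@[simp] lemma signedTransversals_empty : signedTransversals c ∅ = 1 := by
  simp [signedTransversals, transversals, Finset.filter_singleton]

open Classical in
/-- The transversals of `insert a B` containing `a` are those of the part of `B` outside the fibre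
of `a`, with `a` added. -/
lemma signedTransversals_insert {B : Finset α} {a : α} (ha : a ∉ B) :
    signedTransversals c (insert a B) =
      signedTransversals c B - signedTransversals c (B.filter fun b => c b ≠ c a) := by
  have hsub : transversals c (B.filter fun b => c b ≠ c a) ⊆ B.powerset := fun S hS =>
    Finset.mem_powerset.2 ((mem_transversals.1 hS).1.trans (Finset.filter_subset _ _))
  rw [sub_eq_add_neg, signedTransversals, transversals, Finset.sum_filter,
    Finset.sum_powerset_insert ha, ← Finset.sum_filter]
  congr 1
  rw [signedTransversals, ← Finset.sum_neg_distrib, ← Finset.sum_filter]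
  have hset : (B.powerset.filter fun S => Set.InjOn c (insert a S : Finset α)) =
      transversals c (B.filter fun b => c b ≠ c a) := by
    ext S
    rw [mem_transversals, Finset.mem_filter, Finset.mem_powerset]
    constructor
    · rintro ⟨hSB, hinj⟩
      refine ⟨fun b hb => Finset.mem_filter.2 ⟨hSB hb, fun hbc => ?_⟩, hinj.mono (by simp)⟩
      have := hinj (by simp [hb]) (by simp) hbc
      exact ha (this ▸ hSB hb)
    · rintro ⟨hS, hinj⟩
      refine ⟨hS.trans (Finset.filter_subset _ _), ?_⟩
      rw [Finset.coe_insert, Set.injOn_insert fun h => ha (Finset.mem_filter.1 (hS h)).1]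
      refine ⟨hinj, ?_⟩
      rintro ⟨b, hb, hbc⟩
      exact (Finset.mem_filter.1 (hS hb)).2 hbc
  rw [hset]
  refine Finset.sum_congr rfl fun S hS => ?_
  rw [Finset.card_insert_of_notMem fun h =>
    ha (Finset.mem_filter.1 ((mem_transversals.1 hS).1 h)).1, pow_succ]
  ring

/-- If some fibre of `c` meets `B` in exactly one element, then adding or removing that element
cancels the transversals in pairs. -/
lemma signedTransversals_eq_zero {B : Finset α} {a : α} (ha : a ∈ B)
    (huniq : ∀ b ∈ B, c b = c a → b = a) : signedTransversals c B = 0 := by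
  classical
  rw [← Finset.insert_erase ha, signedTransversals_insert (Finset.notMem_erase a B),
    Finset.filter_true_of_mem, sub_self]
  exact fun b hb hbc => Finset.ne_of_mem_erase hb (huniq b (Finset.mem_of_mem_erase hb) hbc)

lemma signedTransversals_of_const {k : κ} (B : Finset α) (hB : ∀ b ∈ B, c b = k) :
    signedTransversals c B = 1 - B.card := by
  classical
  induction B using Finset.induction_on with
  | empty => simp
  | insert a B ha ih =>
    rw [signedTransversals_insert ha, ih fun b hb => hB b (Finset.mem_insert_of_mem hb),
      Finset.filter_false_of_mem, signedTransversals_empty, Finset.card_insert_of_notMem ha]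
    · push_cast; ring
    · intro b hb
      simp [hB b (Finset.mem_insert_of_mem hb), hB a (Finset.mem_insert_self a B)]

end Transversal

/-! ### The hyperplanes of the edges -/

namespace MEdge

variable {n : ℕ}

@[simp] lemma mem_hyperplane_zero {k : Fin n} {v : Fin n → ℂ} :
    v ∈ (zero k).hyperplane ↔ v k = 0 := by
  simp [hyperplane]

@[simp] lemma mem_hyperplane_link {i j : Fin n} {hij : i < j} {ζ : ℂˣ} {v : Fin n → ℂ} :
    v ∈ (link i j hij ζ).hyperplane ↔ v i = ζ * v j := by
  simp [hyperplane, sub_eq_zero]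

lemma single_mem_hyperplane {e : MEdge n} {k : Fin n} (h : e.top < k) :
    (Pi.single k 1 : Fin n → ℂ) ∈ e.hyperplane := by
  cases e with
  | zero l => simpa [Pi.single_apply] using (show l < k from h).ne
  | link i j hij ζ =>
    rw [mem_hyperplane_link, Pi.single_eq_of_ne (hij.trans h).ne, Pi.single_eq_of_ne, mul_zero]
    exact h.ne

lemma single_top_notMem_hyperplane (e : MEdge n) :
    (Pi.single e.top 1 : Fin n → ℂ) ∉ e.hyperplane := by
  cases e with
  | zero l => simp [top]
  | link i j hij ζ => simp [top, Pi.single_eq_of_ne hij.ne, ζ.ne_zero.symm]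

/-- Distinct edges have incomparable hyperplanes. -/
lemma eq_of_hyperplane_le {e f : MEdge n} (h : e.hyperplane ≤ f.hyperplane) : e = f := by
  cases e with
  | zero k =>
    cases f with
    | zero l =>
      by_contra hne
      have hkl : k ≠ l := fun hkl => hne (by rw [hkl])
      have := @h (Pi.single l 1) (by simp [hkl])
      simp at this
    | link i j hij ζ =>
      by_cases hki : k = j
      · have := @h (Pi.single i 1) (by simp [hki, hij.ne'])
        simp [hij.ne'] at this
      · have := @h (Pi.single j 1) (by simp [hki])
        simp [hij.ne, ζ.ne_zero.symm] at this
  | link i j hij ζ =>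
    -- This vector spans the hyperplane together with the basis vectors off `i` and `j`.
    have h0 := @h (Pi.single i (ζ : ℂ) + Pi.single j 1) (by simp [hij.ne, hij.ne'])
    have hs : ∀ k, k ≠ i → k ≠ j → (Pi.single k 1 : Fin n → ℂ) ∈ f.hyperplane :=
      fun k hi hj => h (by simp [hi.symm, hj.symm])
    cases f with
    | zero k =>
      by_cases hki : k = i
      · subst hki; simp [hij.ne] at h0
      · by_cases hkj : k = j
        · subst hkj; simp [hij.ne'] at h0
        · simpa using hs k hki hkj
    | link a b hab ξ =>
      have ha : a = i ∨ a = j := by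
        by_contra! hne
        simpa [hab.ne'] using hs a hne.1 hne.2
      have hb : b = i ∨ b = j := by
        by_contra! hne
        simpa [hab.ne, ξ.ne_zero.symm] using hs b hne.1 hne.2
      rcases ha with rfl | rfl <;> rcases hb with rfl | rfl
      · exact absurd hab (lt_irrefl _)
      · simp [hij.ne, hij.ne'] at h0
        rw [Units.ext h0]
      · exact absurd hab hij.asymm
      · exact absurd hab (lt_irrefl _)

/-- The equations of two edges with the same larger endpoint imply that of the third edge of a
triangle, and of no other edge with a different larger endpoint. -/
lemma link_inf_link_le_iff {i j k : Fin n} (hij : i < j) (hjk : j < k) (α β : ℂˣ) {g : MEdge n}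
    (hg : g.top ≠ k) :
    (link i k (hij.trans hjk) α).hyperplane ⊓ (link j k hjk β).hyperplane ≤ g.hyperplane ↔
      g = link i j hij (α / β) := by
  constructor
  · intro h
    have hik := hij.trans hjk
    have h0 := @h (Pi.single i (α : ℂ) + Pi.single j (β : ℂ) + Pi.single k 1) (by
      simp [hij.ne, hij.ne', hik.ne, hik.ne', hjk.ne, hjk.ne'])
    have hs : ∀ l, l ≠ i → l ≠ j → l ≠ k → (Pi.single l 1 : Fin n → ℂ) ∈ g.hyperplane :=
      fun l hi hj hk => h (by simp [hi.symm, hj.symm, hk.symm])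
    cases g with
    | zero l =>
      change l ≠ k at hg
      by_cases hli : l = i
      · subst hli; simp [hij.ne, hik.ne] at h0
      · by_cases hlj : l = j
        · subst hlj; simp [hij.ne', hjk.ne] at h0
        · simpa using hs l hli hlj hg
    | link a b hab ξ =>
      change b ≠ k at hg
      have ha : a = i ∨ a = j ∨ a = k := by
        by_contra! hne
        simpa [hab.ne'] using hs a hne.1 hne.2.1 hne.2.2
      have hb : b = i ∨ b = j := by
        by_contra! hne
        simpa [hab.ne, ξ.ne_zero.symm] using hs b hne.1 hne.2 hg
      have hai : a = i := by
        rcases ha with rfl | rfl | rfl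
        · rfl
        · rcases hb with rfl | rfl
          · exact absurd hab hij.asymm
          · exact absurd hab (lt_irrefl _)
        · rcases hb with rfl | rfl
          · exact absurd hab hik.asymm
          · exact absurd hab hjk.asymm
      have hbj : b = j := by
        rcases hb with rfl | rfl
        · exact absurd (hai ▸ hab) (lt_irrefl _)
        · rfl
      subst hai hbj
      simp [hij.ne, hij.ne', hik.ne, hjk.ne] at h0
      congr 1
      rw [eq_div_iff_mul_eq']
      exact Units.ext (by rw [Units.val_mul]; exact h0.symm)
  · rintro rfl v ⟨h1, h2⟩
    have h1' := mem_hyperplane_link.1 h1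
    have h2' := mem_hyperplane_link.1 h2
    rw [mem_hyperplane_link, h1', h2', Units.val_div_eq_div_val]
    field_simp

/-- The equations `x_j = 0` and `x_k = 0` imply that of no edge other than `0j`, `0k` and the edges
between `j` and `k`. -/
lemma eq_zero_of_le_hyperplane {j k : Fin n} (hjk : j < k) {W : Submodule ℂ (Fin n → ℂ)}
    (hW : ∀ v : Fin n → ℂ, v j = 0 → v k = 0 → v ∈ W) {g : MEdge n} (hg : g.top ≠ k)
    (h : W ≤ g.hyperplane) : g = zero j := by
  have hs : ∀ l, l ≠ j → l ≠ k → (Pi.single l 1 : Fin n → ℂ) ∈ g.hyperplane :=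
    fun l hj hk => h (hW _ (by simp [hj.symm]) (by simp [hk.symm]))
  cases g with
  | zero l =>
    change l ≠ k at hg
    by_cases hlj : l = j
    · rw [hlj]
    · simpa using hs l hlj hg
  | link a b hab ξ =>
    change b ≠ k at hg
    have hb : b = j := by
      by_contra hne
      simpa [hab.ne, ξ.ne_zero.symm] using hs b hne hg
    subst hb
    simpa [hab.ne'] using hs a hab.ne (hab.trans hjk).ne

lemma eq_zero_of_link_inf_link {j k : Fin n} {hjk : j < k} {γ ε : ℂˣ} (hne : γ ≠ ε)
    {v : Fin n → ℂ} (h1 : v ∈ (link j k hjk γ).hyperplane)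
    (h2 : v ∈ (link j k hjk ε).hyperplane) : v j = 0 := by
  rw [mem_hyperplane_link] at h1 h2
  have h3 : ((γ : ℂ) - ε) * v k = 0 := by rw [sub_mul, ← h1, ← h2, sub_self]
  have h4 : (γ : ℂ) - ε ≠ 0 := sub_ne_zero.2 fun h => hne (Units.ext h)
  rw [h1, (mul_eq_zero.1 h3).resolve_left h4, mul_zero]

end MEdge

namespace LabeledMultigraph

variable {n : ℕ} {G : LabeledMultigraph n}

open MEdge

/-- In a perfectly labeled multigraph, any two edges with the same larger endpoint span a
codimension two flat that lies in the hyperplane of an edge with a smaller larger endpoint. -/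
lemma PerfectlyLabeled.exists_top_lt (hG : G.PerfectlyLabeled) {e f : MEdge n} (he : e ∈ G.edges)
    (hf : f ∈ G.edges) (hne : e ≠ f) (htop : e.top = f.top) :
    ∃ g ∈ G.edges, g.top < e.top ∧ e.hyperplane ⊓ f.hyperplane ≤ g.hyperplane := by
  obtain ⟨h1, h2, h3⟩ := hG
  cases e with
  | zero k =>
    cases f with
    | zero l => exact absurd (congrArg zero htop) hne
    | link j l hjl γ =>
      obtain rfl : k = l := htop
      refine ⟨_, h3 _ _ hjl _ hf he, hjl, ?_⟩
      rintro v ⟨hv, hv'⟩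
      rw [SetLike.mem_coe, mem_hyperplane_zero] at hv
      rw [SetLike.mem_coe, mem_hyperplane_link, hv, mul_zero] at hv'
      exact mem_hyperplane_zero.2 hv'
  | link i k hik α =>
    cases f with
    | zero l =>
      obtain rfl : k = l := htop
      refine ⟨_, h3 _ _ hik _ he hf, hik, ?_⟩
      rintro v ⟨hv', hv⟩
      rw [SetLike.mem_coe, mem_hyperplane_zero] at hv
      rw [SetLike.mem_coe, mem_hyperplane_link, hv, mul_zero] at hv'
      exact mem_hyperplane_zero.2 hv'
    | link j l hjl β =>
      obtain rfl : k = l := htop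
      rcases lt_trichotomy i j with hij | rfl | hij
      · exact ⟨_, h1 i j k hij hjl α β he hf, hjl,
          (link_inf_link_le_iff hij hjl α β (g := link i j hij _) hjl.ne).2 rfl⟩
      · have hαβ : α ≠ β := fun h => hne (by rw [h])
        exact ⟨_, h2 _ _ hik _ _ hαβ he hf, hik, fun v hv =>
          mem_hyperplane_zero.2 (eq_zero_of_link_inf_link hαβ hv.1 hv.2)⟩
      · refine ⟨_, h1 j i k hij hik β α hf he, hik, ?_⟩
        rw [inf_comm]
        exact (link_inf_link_le_iff hij hik β α (g := link j i hij _) hik.ne).2 rfl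

/-- The converse of `PerfectlyLabeled.exists_top_lt`, for which it is enough that the third edge has
a different larger endpoint. -/
lemma perfectlyLabeled_of_exists_top_ne
    (h : ∀ e ∈ G.edges, ∀ f ∈ G.edges, e ≠ f → e.top = f.top →
      ∃ g ∈ G.edges, g.top ≠ e.top ∧ e.hyperplane ⊓ f.hyperplane ≤ g.hyperplane) :
    G.PerfectlyLabeled := by
  refine ⟨fun i j k hij hjk α β he hf => ?_, fun j k hjk γ ε hne he hf => ?_,
    fun j k hjk γ he hf => ?_⟩
  · obtain ⟨g, hg, hgk, hle⟩ := h _ he _ hf (fun h => hij.ne (by injection h)) rfl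
    rwa [← (link_inf_link_le_iff hij hjk α β hgk).1 hle]
  · obtain ⟨g, hg, hgk, hle⟩ := h _ he _ hf (fun h => hne (by injection h)) rfl
    rwa [← eq_zero_of_le_hyperplane hjk (fun v h1 h2 => ?_) hgk hle]
    exact ⟨by simp [h1, h2], by simp [h1, h2]⟩
  · obtain ⟨g, hg, hgk, hle⟩ := h _ he _ hf (fun h => by cases h) rfl
    rwa [← eq_zero_of_le_hyperplane hjk (fun v h1 h2 => ?_) hgk hle]
    exact ⟨by simp [h1, h2], by simp [h2]⟩

end LabeledMultigraph

/-! ### Flats and their ranks -/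

namespace LabeledMultigraph

variable {n : ℕ} (G : LabeledMultigraph n)

open MEdge

/-- The intersection of the hyperplanes of the edges in `S`, as an element of the intersection
lattice. Members of `S` that are not edges of `G` are ignored. -/
def flat (S : Finset (MEdge n)) : G.IntersectionLattice :=
  OrderDual.toDual ⟨sInf (hyperplane '' {e | e ∈ S ∧ e ∈ G.edges}),
    _, Set.image_mono fun _ he => he.2, rfl⟩

open Classical in
/-- The edges whose hyperplanes contain the flat `x`. -/
noncomputable def edgesAbove (x : G.IntersectionLattice) : Finset (MEdge n) :=
  G.edges.filter fun e => (OrderDual.ofDual x).1 ≤ e.hyperplane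

variable {G}

lemma mem_edgesAbove {x : G.IntersectionLattice} {e : MEdge n} :
    e ∈ G.edgesAbove x ↔ e ∈ G.edges ∧ (OrderDual.ofDual x).1 ≤ e.hyperplane := by
  simp [edgesAbove]

lemma le_iff {x y : G.IntersectionLattice} :
    x ≤ y ↔ (OrderDual.ofDual y).1 ≤ (OrderDual.ofDual x).1 := Iff.rfl

lemma lt_iff {x y : G.IntersectionLattice} :
    x < y ↔ (OrderDual.ofDual y).1 < (OrderDual.ofDual x).1 := Iff.rfl

lemma le_flat_iff {S : Finset (MEdge n)} (hS : S ⊆ G.edges) {W : Submodule ℂ (Fin n → ℂ)} :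
    W ≤ (OrderDual.ofDual (G.flat S)).1 ↔ ∀ e ∈ S, W ≤ e.hyperplane := by
  change W ≤ sInf _ ↔ _
  rw [le_sInf_iff]
  exact ⟨fun h e he => h _ ⟨e, ⟨he, hS he⟩, rfl⟩, by rintro h _ ⟨e, he, rfl⟩; exact h e he.1⟩

lemma flat_le_iff {S : Finset (MEdge n)} (hS : S ⊆ G.edges) {x : G.IntersectionLattice} :
    G.flat S ≤ x ↔ S ⊆ G.edgesAbove x := by
  rw [le_iff, le_flat_iff hS]
  exact ⟨fun h e he => mem_edgesAbove.2 ⟨hS he, h e he⟩, fun h e he => (mem_edgesAbove.1 (h he)).2⟩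

lemma flat_le_hyperplane {S : Finset (MEdge n)} (hS : S ⊆ G.edges) {e : MEdge n} (he : e ∈ S) :
    (OrderDual.ofDual (G.flat S)).1 ≤ e.hyperplane :=
  (le_flat_iff hS).1 le_rfl e he

/-- Every flat is the intersection of the hyperplanes containing it. -/
lemma flat_edgesAbove (x : G.IntersectionLattice) : G.flat (G.edgesAbove x) = x := by
  have hsub : G.edgesAbove x ⊆ G.edges := fun e he => (mem_edgesAbove.1 he).1
  refine le_antisymm ((flat_le_iff hsub).2 subset_rfl) ?_
  obtain ⟨B, hB, hBx⟩ := (OrderDual.ofDual x).2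
  rw [le_iff, ← hBx]
  refine le_sInf fun H hH => ?_
  obtain ⟨e, he, rfl⟩ := hB hH
  exact flat_le_hyperplane hsub (mem_edgesAbove.2 ⟨he, hBx ▸ sInf_le hH⟩)

lemma edgesAbove_bot : G.edgesAbove ⊥ = ∅ := by
  refine Finset.eq_empty_of_forall_notMem fun e he => e.single_top_notMem_hyperplane ?_
  exact (mem_edgesAbove.1 he).2 (show _ ∈ (⊤ : Submodule ℂ (Fin n → ℂ)) from Submodule.mem_top)

lemma flat_empty : G.flat ∅ = ⊥ := by
  rw [← edgesAbove_bot, flat_edgesAbove]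

lemma edgesAbove_nonempty {x : G.IntersectionLattice} (hx : x ≠ ⊥) :
    (G.edgesAbove x).Nonempty := by
  rw [Finset.nonempty_iff_ne_empty]
  intro h
  exact hx (by rw [← flat_edgesAbove x, h, flat_empty])

lemma height_le_codim (x : G.IntersectionLattice) :
    Order.height x ≤ (n - Module.finrank ℂ (OrderDual.ofDual x).1 : ℕ) := by
  let f : G.IntersectionLattice → ℕ := fun x => n - Module.finrank ℂ (OrderDual.ofDual x).1
  have hf : StrictMono f := by
    intro x y hxy
    have h1 := Submodule.finrank_lt_finrank_of_lt (lt_iff.1 hxy)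
    have h2 := Submodule.finrank_le (OrderDual.ofDual x).1
    rw [Module.finrank_fin_fun] at h2
    change n - _ < n - _
    omega
  simpa [f] using Order.height_le_height_apply_of_strictMono f hf x

lemma height_lt_top (x : G.IntersectionLattice) : Order.height x < ⊤ :=
  (height_le_codim x).trans_lt (ENat.natCast_lt_top _)

lemma posetRank_le_codim (x : G.IntersectionLattice) :
    posetRank x ≤ n - Module.finrank ℂ (OrderDual.ofDual x).1 :=
  ENat.toNat_le_of_le_natCast (height_le_codim x)

lemma posetRank_le (x : G.IntersectionLattice) : posetRank x ≤ n :=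
  (posetRank_le_codim x).trans (Nat.sub_le _ _)

lemma posetRank_lt {x y : G.IntersectionLattice} (h : x < y) : posetRank x < posetRank y := by
  rw [← Nat.cast_lt (α := ℕ∞), posetRank, posetRank, ENat.natCast_toNat (height_lt_top x).ne,
    ENat.natCast_toNat (height_lt_top y).ne]
  exact Order.height_strictMono h (height_lt_top x)

lemma posetRank_mono {x y : G.IntersectionLattice} (h : x ≤ y) : posetRank x ≤ posetRank y := by
  rcases h.eq_or_lt with rfl | h
  · rfl
  · exact (posetRank_lt h).le

lemma posetRank_bot : posetRank (⊥ : G.IntersectionLattice) = 0 := by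
  simp [posetRank]

/-- Each hyperplane cuts the dimension by at most one. -/
lemma le_finrank_flat_add_card {S : Finset (MEdge n)} (hS : S ⊆ G.edges) :
    n ≤ Module.finrank ℂ (OrderDual.ofDual (G.flat S)).1 + S.card := by
  classical
  induction S using Finset.induction_on with
  | empty =>
    rw [flat_empty]
    change n ≤ Module.finrank ℂ (⊤ : Submodule ℂ (Fin n → ℂ)) + _
    simp
  | insert e S he ih =>
    have hS' := (Finset.insert_subset_iff.1 hS).2
    have heq : (OrderDual.ofDual (G.flat (insert e S))).1 =
        (OrderDual.ofDual (G.flat S)).1 ⊓ e.hyperplane := by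
      refine le_antisymm (le_inf ((le_flat_iff hS').2 fun f hf =>
        flat_le_hyperplane hS (Finset.mem_insert_of_mem hf))
        (flat_le_hyperplane hS (Finset.mem_insert_self e S))) ((le_flat_iff hS).2 fun f hf => ?_)
      rcases Finset.mem_insert.1 hf with rfl | hf
      · exact inf_le_right
      · exact inf_le_left.trans (flat_le_hyperplane hS' hf)
    obtain ⟨φ, hφ⟩ : ∃ φ : (Fin n → ℂ) →ₗ[ℂ] ℂ, e.hyperplane = LinearMap.ker φ := by
      cases e <;> exact ⟨_, rfl⟩
    have h1 := Submodule.finrank_sup_add_finrank_inf_eq (OrderDual.ofDual (G.flat S)).1 e.hyperplane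
    have h2 := Submodule.finrank_le ((OrderDual.ofDual (G.flat S)).1 ⊔ e.hyperplane)
    have h3 := LinearMap.finrank_range_add_finrank_ker φ
    have h4 := Submodule.finrank_le (LinearMap.range φ)
    rw [← hφ] at h3
    rw [Module.finrank_fin_fun] at h2 h3
    rw [Module.finrank_self] at h4
    rw [heq, Finset.card_insert_of_notMem he]
    have := ih hS'
    omega

/-- The hyperplanes of a transversal are linearly independent: their equations are in echelon form.
So the rank of their intersection is their number. -/
lemma posetRank_flat {S : Finset (MEdge n)} (hS : S ∈ transversals MEdge.top G.edges) :
    posetRank (G.flat S) = S.card := by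
  classical
  obtain ⟨hSG, hinj⟩ := mem_transversals.1 hS
  refine le_antisymm ?_ ?_
  · have := posetRank_le_codim (G.flat S)
    have := le_finrank_flat_add_card hSG
    omega
  · clear hS
    induction S using Finset.strongInduction with
    | H S ih =>
    rcases S.eq_empty_or_nonempty with rfl | hne
    · simp
    · obtain ⟨e, he, hmax⟩ := S.exists_max_image MEdge.top hne
      have hsub : S.erase e ⊆ S := Finset.erase_subset e S
      have h := ih _ (Finset.erase_ssubset he) (hsub.trans hSG)
        (hinj.mono (Finset.coe_subset.2 hsub))
      have hlt : G.flat (S.erase e) < G.flat S := by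
        have hle : G.flat (S.erase e) ≤ G.flat S := (le_flat_iff (hsub.trans hSG)).2
          fun f hf => flat_le_hyperplane hSG (hsub hf)
        refine lt_of_le_not_ge hle fun hge => e.single_top_notMem_hyperplane ?_
        refine ((le_iff.1 hge).trans (flat_le_hyperplane hSG he)) ?_
        have : Submodule.span ℂ {(Pi.single e.top 1 : Fin n → ℂ)} ≤
            (OrderDual.ofDual (G.flat (S.erase e))).1 := by
          refine (le_flat_iff (hsub.trans hSG)).2 fun f hf => ?_
          rw [Submodule.span_singleton_le_iff_mem]
          refine single_mem_hyperplane (lt_of_le_of_ne (hmax f (hsub hf)) fun hfe => ?_)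
          exact Finset.ne_of_mem_erase hf (hinj (hsub hf) he hfe)
        exact this (Submodule.mem_span_singleton_self _)
      have := posetRank_lt hlt
      rw [Finset.card_erase_of_mem he] at h
      omega

open Classical in
/-- Two distinct hyperplanes containing `x` meet in a flat of rank two that contains `x`. -/
lemma posetRank_flat_pair {x : G.IntersectionLattice} {e f : MEdge n} (he : e ∈ G.edgesAbove x)
    (hf : f ∈ G.edgesAbove x) (hne : e ≠ f) :
    posetRank (G.flat {e, f}) = 2 ∧ G.flat {e, f} ≤ x := by
  have heG := (mem_edgesAbove.1 he).1
  have hfG := (mem_edgesAbove.1 hf).1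
  have h1 : ({e} : Finset (MEdge n)) ⊆ G.edges := by simpa using heG
  have h2 : ({e, f} : Finset (MEdge n)) ⊆ G.edges := by
    simpa [Finset.insert_subset_iff] using ⟨heG, hfG⟩
  have h01 : posetRank (G.flat {e}) = 1 := by
    rw [posetRank_flat (mem_transversals.2 ⟨h1, by simp⟩), Finset.card_singleton]
  have h12 : G.flat {e} < G.flat {e, f} := by
    refine lt_of_le_not_ge ((le_flat_iff h1).2 fun g hg => flat_le_hyperplane h2 ?_) fun h => ?_
    · rw [Finset.mem_singleton.1 hg]; simp
    · have hle : e.hyperplane ≤ (OrderDual.ofDual (G.flat {e})).1 :=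
        (le_flat_iff h1).2 fun g hg => by rw [Finset.mem_singleton.1 hg]
      exact hne (eq_of_hyperplane_le
        (hle.trans ((le_iff.1 h).trans (flat_le_hyperplane h2 (by simp)))))
  refine ⟨?_, (flat_le_iff h2).2 ?_⟩
  · have := posetRank_lt h12
    have := posetRank_le_codim (G.flat {e, f})
    have := le_finrank_flat_add_card h2
    rw [Finset.card_pair hne] at this
    omega
  · simpa [Finset.insert_subset_iff] using ⟨he, hf⟩

end LabeledMultigraph

/-! ### Möbius function against signed counts of transversals -/

section Moebius

variable {P : Type*} [PartialOrder P] [BoundedOrder P] [Fintype P]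

open Classical in
/-- The value `μ(0̂, x)` of the Möbius function of a finite bounded poset, for the same locally
finite order as in `charPolynomial`. -/
noncomputable def moebius (x : P) : ℤ :=
  letI : LocallyFiniteOrder P := Fintype.toLocallyFiniteOrder
  IncidenceAlgebra.mu ℤ ⊥ x

lemma charPolynomial_eq_sum_moebius :
    charPolynomial P = ∑ x : P, C (moebius x) * X ^ (posetRank (⊤ : P) - posetRank x) := rfl

open Classical in
lemma sum_moebius (x : P) : ∑ y with y ≤ x, moebius y = if x = ⊥ then 1 else 0 := by
  let _ : LocallyFiniteOrder P := Fintype.toLocallyFiniteOrder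
  have h := IncidenceAlgebra.sum_Icc_mu_right (𝕜 := ℤ) (⊥ : P) x
  rw [if_congr (eq_comm (a := x)) rfl rfl, ← h]
  refine Finset.sum_congr ?_ fun _ _ => rfl
  ext y
  simp

end Moebius

namespace LabeledMultigraph

variable {n : ℕ} (G : LabeledMultigraph n)

open MEdge

open Classical in
/-- The number of transversals of the edge set with intersection `x`, counted with the sign
`(-1) ^ |S|`. -/
noncomputable def flatWeight (x : G.IntersectionLattice) : ℤ :=
  ∑ S ∈ (transversals MEdge.top G.edges).filter fun S => G.flat S = x, (-1) ^ S.card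

variable {G}

open Classical in
lemma sum_flatWeight (x : G.IntersectionLattice) :
    ∑ y with y ≤ x, G.flatWeight y = signedTransversals MEdge.top (G.edgesAbove x) := by
  have hT : transversals MEdge.top (G.edgesAbove x) =
      (transversals MEdge.top G.edges).filter fun S => G.flat S ≤ x := by
    ext S
    rw [Finset.mem_filter, mem_transversals, mem_transversals]
    constructor
    · rintro ⟨h, hinj⟩
      have hS : S ⊆ G.edges := fun e he => (mem_edgesAbove.1 (h he)).1
      exact ⟨⟨hS, hinj⟩, (flat_le_iff hS).2 h⟩
    · rintro ⟨⟨hS, hinj⟩, h⟩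
      exact ⟨(flat_le_iff hS).1 h, hinj⟩
  rw [signedTransversals, hT, ← Finset.sum_fiberwise_of_maps_to
    (t := Finset.univ.filter fun y => y ≤ x) (g := G.flat) (fun S hS => by
      simpa using (Finset.mem_filter.1 hS).2)]
  refine Finset.sum_congr rfl fun y hy => ?_
  rw [flatWeight, Finset.filter_filter]
  refine Finset.sum_congr (Finset.filter_congr fun S _ => ?_) fun _ _ => rfl
  exact ⟨fun h => ⟨h ▸ (Finset.mem_filter.1 hy).2, h⟩, fun h => h.2⟩

open Classical in
lemma sum_flatWeight_sub_moebius {x : G.IntersectionLattice} (hx : x ≠ ⊥) :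
    ∑ y with y ≤ x, (G.flatWeight y - moebius y) =
      signedTransversals MEdge.top (G.edgesAbove x) := by
  rw [Finset.sum_sub_distrib, sum_flatWeight, sum_moebius, if_neg hx, sub_zero]

lemma flatWeight_bot : G.flatWeight ⊥ = moebius (⊥ : G.IntersectionLattice) := by
  classical
  have h1 := sum_flatWeight (⊥ : G.IntersectionLattice)
  have h2 := sum_moebius (⊥ : G.IntersectionLattice)
  have h3 : (Finset.univ.filter fun y : G.IntersectionLattice => y ≤ ⊥) = {⊥} := by
    ext y; simp
  rw [h3, Finset.sum_singleton] at h1 h2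
  rw [h1, h2, edgesAbove_bot, signedTransversals_empty, if_pos rfl]

/-- At a minimal flat where the two functions differ, the signed count is their difference. -/
lemma flatWeight_sub_moebius {x : G.IntersectionLattice} (hx : x ≠ ⊥)
    (h : ∀ y < x, G.flatWeight y = moebius y) :
    G.flatWeight x - moebius x = signedTransversals MEdge.top (G.edgesAbove x) := by
  classical
  rw [← sum_flatWeight_sub_moebius hx, Finset.sum_eq_single_of_mem x (by simp)]
  intro y hy hyx
  rw [h y (lt_of_le_of_ne (Finset.mem_filter.1 hy).2 hyx), sub_self]

/-- If the signed count of transversals vanishes above every flat other than `0̂`, then the Möbius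
function counts transversals with sign. -/
lemma flatWeight_eq_moebius
    (h : ∀ x : G.IntersectionLattice, x ≠ ⊥ →
      signedTransversals MEdge.top (G.edgesAbove x) = 0) (x : G.IntersectionLattice) :
    G.flatWeight x = moebius x := by
  induction x using WellFoundedLT.induction with
  | ind x ih =>
    by_cases hx : x = ⊥
    · rw [hx, flatWeight_bot]
    · exact sub_eq_zero.1 ((flatWeight_sub_moebius hx ih).trans (h x hx))

/-! ### Comparison of the two polynomials -/

lemma ISF_eq_sum_transversals :
    G.ISF = ∑ S ∈ transversals MEdge.top G.edges, X ^ (n - S.card) := by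
  classical
  rw [ISF, ← Finset.sum_fiberwise_of_maps_to (t := Finset.range (n + 1)) (g := Finset.card)]
  · refine Finset.sum_congr rfl fun m _ => ?_
    have hset : (G.edges.powerset.filter fun F => IsIncreasingForest F ∧ F.card = m) =
        (transversals MEdge.top G.edges).filter fun S => S.card = m := by
      ext F
      simp [mem_transversals, isIncreasingForest_iff, and_assoc]
    rw [Finset.sum_congr rfl fun S hS => by rw [(Finset.mem_filter.1 hS).2], Finset.sum_const,
      isf, nsmul_eq_mul]
    congr 2
    convert congrArg Finset.card hset
    simp
  · intro S hS
    have := Finset.card_le_card_of_injOn MEdge.top (fun _ _ => Finset.mem_univ _)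
      (mem_transversals.1 hS).2
    rw [Finset.card_univ, Fintype.card_fin] at this
    simpa [Nat.lt_succ_iff] using this

lemma ISF_eq_sum_flatWeight :
    G.ISF = ∑ x, C (G.flatWeight x * (-1) ^ posetRank x) * X ^ (n - posetRank x) := by
  classical
  rw [ISF_eq_sum_transversals, ← Finset.sum_fiberwise_of_maps_to (t := Finset.univ) (g := G.flat)
    fun _ _ => Finset.mem_univ _]
  refine Finset.sum_congr rfl fun x _ => ?_
  rw [flatWeight, Finset.sum_mul, map_sum, Finset.sum_mul]
  refine Finset.sum_congr rfl fun S hS => ?_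
  obtain ⟨hST, rfl⟩ := Finset.mem_filter.1 hS
  rw [posetRank_flat hST, ← mul_pow]
  simp

variable (G) in
lemma charPolynomial_comp_eq_sum_moebius :
    (-1) ^ G.rank * X ^ (n - G.rank) * (charPolynomial G.IntersectionLattice).comp (-X) =
      ∑ x : G.IntersectionLattice,
        C (moebius x * (-1) ^ posetRank x) * X ^ (n - posetRank x) := by
  classical
  rw [charPolynomial_eq_sum_moebius, Polynomial.sum_comp, Finset.mul_sum]
  refine Finset.sum_congr rfl fun x _ => ?_
  obtain ⟨a, ha⟩ := Nat.exists_eq_add_of_le (posetRank_mono (le_top (a := x)))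
  obtain ⟨b, hb⟩ := Nat.exists_eq_add_of_le (posetRank_le (⊤ : G.IntersectionLattice))
  have hr : G.rank = posetRank x + a := ha
  have h1 : n - G.rank = b := by unfold rank; omega
  have h2 : posetRank (⊤ : G.IntersectionLattice) - posetRank x = a := by omega
  have h3 : n - posetRank x = a + b := by unfold rank at *; omega
  have h4 : ((-1 : ℤ[X]) ^ a) * (-1) ^ a = 1 := by rw [← mul_pow]; simp
  rw [h1, h2, h3, hr]
  simp only [mul_comp, C_comp, pow_comp, X_comp, C_mul, C_pow, C_neg, C_1]
  rw [neg_pow (X : ℤ[X]) a, pow_add, pow_add]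
  linear_combination (C (moebius x) * (-1) ^ posetRank x * X ^ a * X ^ b) * h4

/-- In a perfectly labeled multigraph, the smallest vertex that is the larger endpoint of an edge
above `x` is so for only one such edge. -/
lemma PerfectlyLabeled.signedTransversals_eq_zero (hG : G.PerfectlyLabeled)
    {x : G.IntersectionLattice} (hx : x ≠ ⊥) :
    signedTransversals MEdge.top (G.edgesAbove x) = 0 := by
  obtain ⟨e, he, hmin⟩ := (G.edgesAbove x).exists_min_image MEdge.top (edgesAbove_nonempty hx)
  refine _root_.signedTransversals_eq_zero he fun f hf hfe => ?_
  by_contra hne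
  obtain ⟨g, hg, hlt, hle⟩ := hG.exists_top_lt (mem_edgesAbove.1 hf).1 (mem_edgesAbove.1 he).1
    hne hfe
  refine (hfe ▸ hlt).not_ge (hmin g (mem_edgesAbove.2 ⟨hg, le_trans (le_inf ?_ ?_) hle⟩))
  · exact (mem_edgesAbove.1 hf).2
  · exact (mem_edgesAbove.1 he).2

/-- If the signed count of transversals above a flat of rank two is not zero, then all edges above
it have the same larger endpoint. Otherwise two classes occur; the lower one has at least two edges
there, as an edge alone in its class would make the count vanish. These span the flat, so its points
have unrestricted coordinate at the higher endpoint, against the equation of an edge of the higher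
class. -/
lemma top_eq_of_posetRank_eq_two {x : G.IntersectionLattice} (hx : posetRank x = 2)
    (h0 : signedTransversals MEdge.top (G.edgesAbove x) ≠ 0) {e f : MEdge n}
    (he : e ∈ G.edgesAbove x) (hf : f ∈ G.edgesAbove x) : e.top = f.top := by
  classical
  wlog hlt : e.top < f.top generalizing e f
  · rcases lt_or_eq_of_le (not_lt.1 hlt) with h | h
    · exact (this hf he h).symm
    · exact h.symm
  exfalso
  refine h0 (signedTransversals_eq_zero he fun g hg hge => ?_)
  by_contra hne
  obtain ⟨h2, hle⟩ := posetRank_flat_pair hg he hne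
  have heq : G.flat {g, e} = x := by
    rcases hle.eq_or_lt with h | h
    · exact h
    · have := posetRank_lt h
      omega
  have hsub : ({g, e} : Finset (MEdge n)) ⊆ G.edges := by
    simpa [Finset.insert_subset_iff] using ⟨(mem_edgesAbove.1 hg).1, (mem_edgesAbove.1 he).1⟩
  have hspan : Submodule.span ℂ {(Pi.single f.top 1 : Fin n → ℂ)} ≤
      (OrderDual.ofDual (G.flat {g, e})).1 := by
    refine (le_flat_iff hsub).2 fun b hb => ?_
    rw [Submodule.span_singleton_le_iff_mem]
    rcases Finset.mem_insert.1 hb with rfl | hb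
    · exact single_mem_hyperplane (hge ▸ hlt)
    · exact single_mem_hyperplane (Finset.mem_singleton.1 hb ▸ hlt)
  rw [heq] at hspan
  exact f.single_top_notMem_hyperplane
    ((mem_edgesAbove.1 hf).2 (hspan (Submodule.mem_span_singleton_self _)))

lemma flatWeight_eq_moebius_of_posetRank_lt (x : G.IntersectionLattice) (hx : posetRank x < 2) :
    G.flatWeight x = moebius x := by
  classical
  induction x using WellFoundedLT.induction with
  | ind x ih =>
    by_cases hb : x = ⊥
    · rw [hb, flatWeight_bot]
    · refine sub_eq_zero.1 ((flatWeight_sub_moebius hb fun y hy =>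
        ih y hy ((posetRank_lt hy).trans hx)).trans ?_)
      obtain ⟨e, he⟩ := edgesAbove_nonempty hb
      refine signedTransversals_eq_zero he fun f hf _ => ?_
      by_contra hne
      obtain ⟨h2, hle⟩ := posetRank_flat_pair hf he hne
      have := posetRank_mono hle
      omega

lemma flatWeight_sub_moebius_of_posetRank_eq_two {x : G.IntersectionLattice}
    (hx : posetRank x = 2) :
    G.flatWeight x - moebius x = signedTransversals MEdge.top (G.edgesAbove x) :=
  flatWeight_sub_moebius (by rintro rfl; simp [posetRank_bot] at hx) fun y hy =>
    flatWeight_eq_moebius_of_posetRank_lt y (hx ▸ posetRank_lt hy)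

lemma signedTransversals_nonpos {x : G.IntersectionLattice} (hx : posetRank x = 2) :
    signedTransversals MEdge.top (G.edgesAbove x) ≤ 0 := by
  by_cases h0 : signedTransversals MEdge.top (G.edgesAbove x) = 0
  · exact h0.le
  obtain ⟨e, he⟩ := edgesAbove_nonempty (x := x) (by rintro rfl; simp [posetRank_bot] at hx)
  rw [signedTransversals_of_const (k := e.top) _ fun f hf =>
    top_eq_of_posetRank_eq_two hx h0 hf he]
  have : 0 < (G.edgesAbove x).card := Finset.card_pos.2 ⟨e, he⟩
  omega

/-- Equality of the polynomials in degree `n - 2` already forces every sum over a flat of rank two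
to vanish, because all of these sums have the same sign. -/
lemma signedTransversals_eq_zero_of_ISF_eq
    (h : G.ISF = (-1) ^ G.rank * X ^ (n - G.rank) *
      (charPolynomial G.IntersectionLattice).comp (-X))
    {x : G.IntersectionLattice} (hx : posetRank x = 2) :
    signedTransversals MEdge.top (G.edgesAbove x) = 0 := by
  classical
  have hcoeff : ∀ w : G.IntersectionLattice → ℤ,
      (∑ y, C (w y * (-1) ^ posetRank y) * X ^ (n - posetRank y) : ℤ[X]).coeff (n - 2) =
        ∑ y with posetRank y = 2, w y := by
    intro w
    rw [finsetSum_coeff, Finset.sum_filter]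
    refine Finset.sum_congr rfl fun y _ => ?_
    have h2 : 2 ≤ n := hx ▸ posetRank_le x
    have hy := posetRank_le y
    rw [coeff_C_mul, coeff_X_pow]
    by_cases hy2 : posetRank y = 2
    · simp [hy2]
    · rw [if_neg hy2, if_neg (by omega), mul_zero]
  rw [charPolynomial_comp_eq_sum_moebius, ISF_eq_sum_flatWeight] at h
  have h' := congrArg (fun p => p.coeff (n - 2)) h
  simp only [hcoeff] at h'
  rw [← sub_eq_zero, ← Finset.sum_sub_distrib, Finset.sum_congr rfl fun y hy =>
    flatWeight_sub_moebius_of_posetRank_eq_two (Finset.mem_filter.1 hy).2,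
    Finset.sum_eq_zero_iff_of_nonpos fun y hy =>
      signedTransversals_nonpos (Finset.mem_filter.1 hy).2] at h'
  exact h' x (by simpa using hx)

lemma perfectlyLabeled_of_ISF_eq
    (h : G.ISF = (-1) ^ G.rank * X ^ (n - G.rank) *
      (charPolynomial G.IntersectionLattice).comp (-X)) : G.PerfectlyLabeled := by
  classical
  refine perfectlyLabeled_of_exists_top_ne fun e he f hf hne htop => ?_
  have hsub : ({e, f} : Finset (MEdge n)) ⊆ G.edges := by
    simpa [Finset.insert_subset_iff] using ⟨he, hf⟩
  have habove := (flat_le_iff hsub).1 (le_refl (G.flat {e, f}))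
  have he' := habove (Finset.mem_insert_self e {f})
  have hf' := habove (Finset.mem_insert_of_mem (Finset.mem_singleton_self f))
  have h0 := signedTransversals_eq_zero_of_ISF_eq h (posetRank_flat_pair he' hf' hne).1
  by_contra! hcon
  -- If all edges above `e ∩ f` were in one class, the signed count would be `1 - a` with `a ≥ 2`.
  rw [signedTransversals_of_const (k := e.top)] at h0
  · have h1 := Finset.card_le_card habove
    rw [Finset.card_pair hne] at h1
    omega
  · intro g hg
    by_contra hge
    refine hcon g (mem_edgesAbove.1 hg).1 hge (le_trans ?_ (mem_edgesAbove.1 hg).2)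
    refine (le_flat_iff hsub).2 fun b hb => ?_
    rcases Finset.mem_insert.1 hb with rfl | hb
    · exact inf_le_left
    · exact Finset.mem_singleton.1 hb ▸ inf_le_right

end LabeledMultigraph

theorem theorem4p2 (n : ℕ) (hn : 0 < n) (G : LabeledMultigraph n) :
    G.ISF = (-1) ^ G.rank * X ^ (n - G.rank) *
        (charPolynomial G.IntersectionLattice).comp (-X) ↔
      G.PerfectlyLabeled := by
  refine ⟨LabeledMultigraph.perfectlyLabeled_of_ISF_eq, fun hG => ?_⟩
  rw [LabeledMultigraph.charPolynomial_comp_eq_sum_moebius,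
    LabeledMultigraph.ISF_eq_sum_flatWeight]
  refine Finset.sum_congr rfl fun x _ => ?_
  rw [LabeledMultigraph.flatWeight_eq_moebius fun y hy => hG.signedTransversals_eq_zero hy]
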